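/- For an integer $r>1$ and $\mathbf s=(s_0,\dots,s_{r-1})\in\{0,1\}^r$ let $T(r,\mathbf s;\cdot):[0,1]\to[0,1]$ be the "flipped" base-$r$ map $$T(r,\mathbf s;x)=s_i+(-1)^{s_i}\{rx\}\quad\text{if }x\in[i/r,(i+1)/r),\ 0\le i\le r-1,\qquad T(r,\mathbf s;1)=0,$$ where $\{\cdot\}$ denotes the fractional part; so on $[i/r,(i+1)/r)$ the map equals $\{rx\}$ if $s_i=0$ and $1-\{rx\}$ if $s_i=1$. Let $\lambda$ be Lebesgue measure on $[0,1]$. For $T:[0,1]\to[0,1]$ ergodic and $\lambda$-preserving, a point $x\in[0,1]$ is called $T$-generic if $$\lim_{N\to\infty}\frac1N\sum_{n=0}^{N-1}f(T^nx)=\int_0^1 f\,d\lambda$$ for every continuous $f:[0,1]\to\mathbb R$; two such maps are generic point equivalent if they have the same set of generic points. Then: (1) For every integer $r>1$ and every $\mathbf s\in\{0,1\}^r$, the map $T(r,\mathbf s;\cdot)$ preserves $\lambda$ and is ergodic with respect to $\lambda$. (2) If $q,r>1$ are integers that are multiplicatively dependent, that is, $q^ir^j=1$ for some $(i,j)\in\mathbb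 Z^2\setminus\{(0,0)\}$, then for all $\mathbf t\in\{0,1\}^q$ and $\mathbf s\in\{0,1\}^r$ the maps $T(q,\mathbf t;\cdot)$ and $T(r,\mathbf s;\cdot)$ are generic point equivalent. (3) In particular, the tent map $f$ on $[0,1]$, given by $f(x)=2x$ for $0\le x<1/2$ and $f(x)=2(1-x)$ for $1/2\le x\le1$, which is $T(2,(0,1);\cdot)$, and the doubling map $x\mapsto\{2x\}$ on $[0,1]$, which is $T(2,(0,0);\cdot)$, are generic point equivalent. For each of these two maps the generic points are exactly the numbers $x\in[0,1]$ that are normal in base $2$, i.e. in whose binary expansion every pattern of length $L$ occurs with relative frequency tending to $2^{-L}$, for every $L$. -/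

import Mathlib

open MeasureTheory Filter Topology

/-- Nonzero integers `m` and `n` are multiplicatively dependent if `m ^ i * n ^ j = 1` for some pair
of integer exponents `(i, j) ≠ (0, 0)`. -/
def MultiplicativelyDependent (m n : ℤ) : Prop :=
  m ≠ 0 ∧ n ≠ 0 ∧ ∃ p : ℤ × ℤ, p ≠ (0, 0) ∧ (m : ℚ) ^ p.1 * (n : ℚ) ^ p.2 = 1

/-- `x` is generic for the system `(X, μ, T)`: the time averages along the orbit of `x` of every
continuous function on `X` converge to its space average. -/
def IsGenericFor {X : Type*} [TopologicalSpace X] [MeasurableSpace X] (μ : Measure X)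
    (T : X → X) (x : X) : Prop :=
  ∀ f : C(X, ℝ), Tendsto (fun N : ℕ => birkhoffAverage ℝ T f N x) atTop (𝓝 (∫ y, f y ∂μ))

/-- The systems `(X, μ, T)` and `(X, ν, S)` have the same generic points. -/
def GenericPointEquivalent {X : Type*} [TopologicalSpace X] [MeasurableSpace X]
    (μ : Measure X) (T : X → X) (ν : Measure X) (S : X → X) : Prop :=
  {x | IsGenericFor μ T x} = {x | IsGenericFor ν S x}

/-- The value at `x` of the flipped base-`r` map with flips `s`. For `0 ≤ x ≤ 1` and `r > 0` one has
`x ∈ [i/r, (i+1)/r)` exactly when `⌊r * x⌋₊ = i`, and the second case is exactly `x = 1`. -/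
noncomputable def flippedValue (r : ℕ) (s : Fin r → Fin 2) (x : ℝ) : ℝ :=
  if h : ⌊(r : ℝ) * x⌋₊ < r then
    ((s ⟨⌊(r : ℝ) * x⌋₊, h⟩ : ℕ) : ℝ)
      + (-1 : ℝ) ^ (s ⟨⌊(r : ℝ) * x⌋₊, h⟩ : ℕ) * Int.fract ((r : ℝ) * x)
  else 0

theorem flippedValue_mem (r : ℕ) (s : Fin r → Fin 2) (x : ℝ) :
    flippedValue r s x ∈ Set.Icc (0 : ℝ) 1 := by
  have h0 := Int.fract_nonneg ((r : ℝ) * x)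
  have h1 := (Int.fract_lt_one ((r : ℝ) * x)).le
  unfold flippedValue
  split_ifs with h
  · generalize s ⟨⌊(r : ℝ) * x⌋₊, h⟩ = a
    fin_cases a <;> simp [h0, h1]
  · simp

/-- The flipped base-`r` map `T(r, s; ·) : [0,1] → [0,1]`. -/
noncomputable def flippedMap (r : ℕ) (s : Fin r → Fin 2) (x : unitInterval) : unitInterval :=
  ⟨flippedValue r s x, flippedValue_mem r s x⟩

/-- The map `x ↦ {2x}` on `[0,1]`. -/
noncomputable def doublingMap (x : unitInterval) : unitInterval :=
  ⟨Int.fract (2 * (x : ℝ)), Int.fract_nonneg _, (Int.fract_lt_one _).le⟩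

/-- The tent map on `[0,1]`. -/
noncomputable def tentMap (x : unitInterval) : unitInterval :=
  ⟨if (x : ℝ) < 1 / 2 then 2 * (x : ℝ) else 2 * (1 - (x : ℝ)), by
    have h0 := x.2.1
    have h1 := x.2.2
    split_ifs <;> constructor <;> linarith⟩

/-- `x ∈ [0,1]` is normal in base `b`: in the base-`b` expansion of `x`, every digit pattern `w` of
length `L` occurs with relative frequency tending to `b ^ (-L)`. -/
def IsNormalInBase (b : ℕ) [NeZero b] (x : unitInterval) : Prop :=
  ∀ (L : ℕ) (w : Fin L → Fin b),
    Tendsto (fun N : ℕ =>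
        (((Finset.range N).filter
          (fun n => ∀ j : Fin L, Real.digits (x : ℝ) b (n + j) = w j)).card : ℝ) / (N : ℝ))
      atTop (𝓝 (1 / (b : ℝ) ^ L))

/-! The engine is a hot spot principle: if `T` is ergodic with almost everywhere continuous
iterates, and along the orbit of `x` the averages of every continuous `f ≥ 0` are asymptotically at
most `C * ∫ f`, then `x` is already generic. Indeed, let `A` be the `M`-step average of `f`. For
large `M` the mean ergodic theorem makes `∫ |A - ∫ f|` small. Domination extends to this almost
everywhere continuous function, so `A` is close to `∫ f` on average along the orbit, while the orbit
averages of `A` and of `f` differ by `o(1)`. See `IsDominatedSeq.isGenericFor`.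

Hence constant factors cost nothing when genericity is transferred between maps. Changing the flips
alters each orbit point at most by `y ↦ 1 - y`, which costs a factor `2`. Passing between the
unflipped map and its `k`-th iterate, which is the unflipped base-`r ^ k` map, costs a factor `k`
either way. Multiplicative dependence gives `q ^ a = r ^ b` with `a, b > 0`, so both maps are
compared with the same unflipped map.

Ergodicity comes from the transfer operator: its inverse branches contract by `r`, so its iterates
flatten every continuous function to its mean. Genericity for the unflipped map is normality because
cylinder indicators are almost everywhere continuous and, conversely, their combinations approximate
continuous functions uniformly on `[0,1)`. -/

section Dominated

/-! ### Dominated sequences and almost everywhere continuous test functions. -/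

variable {X : Type*} [TopologicalSpace X] [MeasurableSpace X]

/-- The time averages of every nonnegative continuous function along `u` are asymptotically at most
`C` times its space average. -/
def IsDominatedSeq (μ : Measure X) (C : ℝ) (u : ℕ → X) : Prop :=
  ∀ f : C(X, ℝ), (∀ x, 0 ≤ f x) → ∀ ε : ℝ, 0 < ε → ∀ᶠ N : ℕ in atTop,
    (N : ℝ)⁻¹ * ∑ n ∈ Finset.range N, f (u n) ≤ C * (∫ y, f y ∂μ) + ε

theorem IsGenericFor.isDominatedSeq {μ : Measure X} {T : X → X} {x : X} (h : IsGenericFor μ T x) :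
    IsDominatedSeq μ 1 (fun n => T^[n] x) := by
  intro f _ ε hε
  filter_upwards [(h f).eventually_lt_const (lt_add_of_pos_right _ hε)] with N hN
  simpa [birkhoffAverage, birkhoffSum] using hN.le

theorem exists_continuous_majorant_indicator [HasOuterApproxClosed X] [OpensMeasurableSpace X]
    (μ : Measure X) [IsFiniteMeasure μ] {D : Set X} (hD : IsClosed D) (hμD : μ D = 0)
    {δ : ℝ} (hδ : 0 < δ) :
    ∃ χ : C(X, ℝ), (∀ x, 0 ≤ χ x) ∧ (∀ x, χ x ≤ 1) ∧ (∀ x ∈ D, χ x = 1) ∧ ∫ x, χ x ∂μ ≤ δ := by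
  have h := HasOuterApproxClosed.tendsto_lintegral_apprSeq hD μ
  rw [hμD] at h
  obtain ⟨n, hn⟩ := (h.eventually_lt_const (ENNReal.ofReal_pos.2 hδ)).exists
  refine ⟨⟨fun x => ((hD.apprSeq n x : NNReal) : ℝ), by fun_prop⟩, fun x => NNReal.coe_nonneg _,
    fun x => ?_, fun x hx => ?_, ?_⟩
  · exact_mod_cast HasOuterApproxClosed.apprSeq_apply_le_one hD n x
  · change ((hD.apprSeq n x : NNReal) : ℝ) = 1
    exact_mod_cast HasOuterApproxClosed.apprSeq_apply_eq_one hD n hx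
  · simp only [ContinuousMap.coe_mk]
    rw [integral_eq_lintegral_of_nonneg_ae (ae_of_all _ fun x => NNReal.coe_nonneg _)
      (by fun_prop)]
    simp only [ENNReal.ofReal_coe_nnreal]
    exact ENNReal.toReal_le_of_le_ofReal hδ.le hn.le

variable [CompactSpace X] [OpensMeasurableSpace X]

theorem ContinuousMap.integrable_of_isFiniteMeasure (μ : Measure X) [IsFiniteMeasure μ]
    (f : C(X, ℝ)) : Integrable f μ := by
  obtain ⟨B, hB⟩ := (isCompact_range f.continuous).isBounded.exists_norm_le
  exact Integrable.of_bound f.continuous.measurable.aestronglyMeasurable B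
    (ae_of_all _ fun x => hB _ ⟨x, rfl⟩)

variable [HasOuterApproxClosed X]

/-- Domination extends to functions that are continuous outside a closed null set. -/
theorem IsDominatedSeq.eventually_le {μ : Measure X} [IsFiniteMeasure μ] {C : ℝ} {u : ℕ → X}
    (hu : IsDominatedSeq μ C u) (hC : 0 ≤ C) {D : Set X} (hD : IsClosed D) (hμD : μ D = 0)
    {h : X → ℝ} {B : ℝ} (hi : Integrable h μ) (h0 : ∀ x, 0 ≤ h x) (hB : ∀ x, h x ≤ B)
    (hc : ∀ x ∉ D, ContinuousAt h x) {ε : ℝ} (hε : 0 < ε) :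
    ∀ᶠ N : ℕ in atTop,
      (N : ℝ)⁻¹ * ∑ n ∈ Finset.range N, h (u n) ≤ C * (∫ y, h y ∂μ) + ε := by
  set K : ℝ := max B 0
  have hK0 : 0 ≤ K := le_max_right _ _
  have hhK : ∀ x, h x ≤ K := fun x => (hB x).trans (le_max_left _ _)
  have hCK : 0 ≤ C * K := mul_nonneg hC hK0
  obtain ⟨χ, χ0, χ1, χD, χi⟩ := exists_continuous_majorant_indicator μ hD hμD
    (show 0 < ε / 2 / (C * K + 1) by positivity)
  -- A continuous majorant of `h`: on `D` the factor `1 - χ` vanishes and squeezes out the jumps of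
  -- `h`, and `K * χ` restores the upper bound at small cost in the integral.
  have hφ : Continuous fun x => h x * (1 - χ x) + K * χ x := by
    refine Continuous.add ?_ (by fun_prop)
    rw [continuous_iff_continuousAt]
    intro x
    by_cases hx : x ∈ D
    · have h1 : Tendsto (fun y => K * (1 - χ y)) (𝓝 x) (𝓝 0) := by
        have : Continuous fun y => K * (1 - χ y) := by fun_prop
        simpa [χD x hx] using this.tendsto x
      have : ContinuousAt (fun y => h y * (1 - χ y)) x := by
        unfold ContinuousAt
        simp only [χD x hx, sub_self, mul_zero]
        refine tendsto_of_tendsto_of_tendsto_of_le_of_le tendsto_const_nhds h1 (fun y => ?_)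
          (fun y => ?_)
        · exact mul_nonneg (h0 y) (sub_nonneg.2 (χ1 y))
        · exact mul_le_mul_of_nonneg_right (hhK y) (sub_nonneg.2 (χ1 y))
      exact this
    · exact (hc x hx).mul (by fun_prop)
  let φ : C(X, ℝ) := ⟨_, hφ⟩
  have hφ0 : ∀ x, 0 ≤ φ x := fun x =>
    add_nonneg (mul_nonneg (h0 x) (sub_nonneg.2 (χ1 x))) (mul_nonneg hK0 (χ0 x))
  have hhφ : ∀ x, h x ≤ φ x := fun x => by
    change h x ≤ h x * (1 - χ x) + K * χ x
    nlinarith [mul_le_mul_of_nonneg_right (hhK x) (χ0 x)]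
  have hχint := χ.integrable_of_isFiniteMeasure μ
  have hint : ∫ x, φ x ∂μ ≤ (∫ x, h x ∂μ) + K * (ε / 2 / (C * K + 1)) := by
    calc ∫ x, φ x ∂μ ≤ ∫ x, (h x + K * χ x) ∂μ := by
          refine integral_mono (φ.integrable_of_isFiniteMeasure μ) (hi.add (hχint.const_mul K))
            fun x => ?_
          change h x * (1 - χ x) + K * χ x ≤ h x + K * χ x
          nlinarith [mul_nonneg (h0 x) (χ0 x)]
      _ = (∫ x, h x ∂μ) + K * ∫ x, χ x ∂μ := by
          rw [integral_add hi (hχint.const_mul K), integral_const_mul]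
      _ ≤ _ := by gcongr
  have hfin : C * (K * (ε / 2 / (C * K + 1))) ≤ ε / 2 := by
    have : C * (K * (ε / 2 / (C * K + 1))) = ε / 2 * (C * K / (C * K + 1)) := by ring
    rw [this]
    refine mul_le_of_le_one_right (by positivity) ?_
    rw [div_le_one (by positivity)]
    linarith
  filter_upwards [hu φ hφ0 (ε / 2) (by positivity)] with N hN
  calc (N : ℝ)⁻¹ * ∑ n ∈ Finset.range N, h (u n)
      ≤ (N : ℝ)⁻¹ * ∑ n ∈ Finset.range N, φ (u n) := by
        gcongr with n _
        exact hhφ _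
    _ ≤ C * (∫ y, φ y ∂μ) + ε / 2 := hN
    _ ≤ C * ((∫ x, h x ∂μ) + K * (ε / 2 / (C * K + 1))) + ε / 2 := by gcongr
    _ ≤ _ := by linarith

/-- Along a generic orbit, the time averages of a bounded function that is continuous outside a
closed null set converge to its space average. -/
theorem IsGenericFor.tendsto_average {μ : Measure X} [IsProbabilityMeasure μ] {T : X → X} {x : X}
    (hx : IsGenericFor μ T x) {D : Set X} (hD : IsClosed D) (hμD : μ D = 0)
    {h : X → ℝ} {B : ℝ} (hi : Integrable h μ) (hB : ∀ x, |h x| ≤ B)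
    (hc : ∀ x ∉ D, ContinuousAt h x) :
    Tendsto (fun N : ℕ => (N : ℝ)⁻¹ * ∑ n ∈ Finset.range N, h (T^[n] x)) atTop
      (𝓝 (∫ y, h y ∂μ)) := by
  have hu := hx.isDominatedSeq
  rw [Metric.tendsto_atTop']
  refine fun ε hε => eventually_atTop.1 ?_ |>.imp fun N hN n hn => hN n hn.le
  -- Upper bounds for the nonnegative functions `B + h` and `B - h` give both halves of the limit.
  have h1 := hu.eventually_le zero_le_one hD hμD (h := fun y => B + h y) (B := 2 * B)
    ((integrable_const B).add hi) (fun y => by linarith [neg_le_of_abs_le (hB y)])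
    (fun y => by linarith [le_of_abs_le (hB y)]) (fun y hy => continuousAt_const.add (hc y hy))
    (half_pos hε)
  have h2 := hu.eventually_le zero_le_one hD hμD (h := fun y => B - h y) (B := 2 * B)
    ((integrable_const B).sub hi) (fun y => by linarith [le_of_abs_le (hB y)])
    (fun y => by linarith [neg_le_of_abs_le (hB y)]) (fun y hy => continuousAt_const.sub (hc y hy))
    (half_pos hε)
  filter_upwards [h1, h2, eventually_gt_atTop 0] with N h1 h2 hN
  have hN' : (N : ℝ) ≠ 0 := by positivity
  rw [integral_add (integrable_const B) hi, Finset.sum_add_distrib, mul_add] at h1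
  rw [integral_sub (integrable_const B) hi, Finset.sum_sub_distrib, mul_sub] at h2
  simp only [Finset.sum_const, Finset.card_range, nsmul_eq_mul, integral_const, probReal_univ,
    one_smul, one_mul, inv_mul_cancel_left₀ hN'] at h1 h2
  rw [Real.dist_eq, abs_lt]
  constructor <;> linarith

end Dominated

/-! ### Mean ergodic theorem in `L¹`. -/

section MeanErgodic

variable {X : Type*} [MeasurableSpace X] {μ : Measure X} [IsProbabilityMeasure μ]

/-- The mean ergodic theorem for an ergodic map, with convergence in mean. -/
theorem Ergodic.tendsto_integral_abs_birkhoffAverage_sub {T : X → X} (hT : Ergodic T μ)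
    {g : X → ℝ} (hg : MemLp g 2 μ) :
    Tendsto (fun M : ℕ => ∫ x, |birkhoffAverage ℝ T g M x - ∫ y, g y ∂μ| ∂μ) atTop (𝓝 0) := by
  have hmp := hT.toMeasurePreserving
  let U : Lp ℝ 2 μ →L[ℝ] Lp ℝ 2 μ :=
    (Lp.compMeasurePreservingₗᵢ ℝ T hmp).toContinuousLinearMap
  have hU : ∀ F : Lp ℝ 2 μ, U F = Lp.compMeasurePreserving T hmp F := fun F => rfl
  let G : Lp ℝ 2 μ := hg.toLp g
  -- Von Neumann's theorem for the Koopman isometry; the limit `P` is invariant, hence constant by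
  -- ergodicity.
  have hlim := U.tendsto_birkhoffAverage_orthogonalProjection
    (LinearIsometry.norm_toContinuousLinearMap_le _) G
  set P : Lp ℝ 2 μ := ((U.eqLocus (1 : Lp ℝ 2 μ →L[ℝ] Lp ℝ 2 μ)).orthogonalProjectionOnto G :
    Lp ℝ 2 μ)
  have hPfix : U P = P := ((U.eqLocus (1 : Lp ℝ 2 μ →L[ℝ] Lp ℝ 2 μ)).orthogonalProjectionOnto G).2
  obtain ⟨c, hc⟩ : ∃ c, (P : X → ℝ) =ᵐ[μ] Function.const X c := by
    refine hT.ae_eq_const_of_ae_eq_comp_ae (Lp.aestronglyMeasurable P) ?_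
    refine (Lp.coeFn_compMeasurePreserving P hmp).symm.trans ?_
    rw [← hU, hPfix]
  have hiter : ∀ n : ℕ, ((U^[n] G : Lp ℝ 2 μ) : X → ℝ) =ᵐ[μ] g ∘ T^[n] := by
    intro n
    induction n with
    | zero => exact hg.coeFn_toLp
    | succ n ih =>
      rw [Function.iterate_succ_apply', hU]
      refine (Lp.coeFn_compMeasurePreserving _ hmp).trans ?_
      have := hmp.quasiMeasurePreserving.ae_eq_comp ih
      simpa [Function.comp_assoc, ← Function.iterate_succ] using this
  have hsum : ∀ n : ℕ, ((birkhoffSum U _root_.id n G : Lp ℝ 2 μ) : X → ℝ)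
      =ᵐ[μ] birkhoffSum T g n := by
    intro n
    induction n with
    | zero => simpa using Lp.coeFn_zero ℝ 2 μ
    | succ n ih =>
      rw [birkhoffSum_succ]
      filter_upwards [Lp.coeFn_add (birkhoffSum U _root_.id n G) (U^[n] G), ih, hiter n]
        with x h1 h2 h3
      simp only [id_eq] at h1 ⊢
      rw [h1, Pi.add_apply, h2, h3, birkhoffSum_succ]
      rfl
  have havg : ∀ n : ℕ, ((birkhoffAverage ℝ U _root_.id n G : Lp ℝ 2 μ) : X → ℝ)
      =ᵐ[μ] birkhoffAverage ℝ T g n := by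
    intro n
    filter_upwards [Lp.coeFn_smul ((n : ℝ)⁻¹) (birkhoffSum U _root_.id n G), hsum n] with x h1 h2
    rw [birkhoffAverage, h1, Pi.smul_apply, h2, birkhoffAverage]
  have hgi : Integrable g μ := hg.integrable (by norm_num)
  have hAi : ∀ n, Integrable (birkhoffAverage ℝ T g n) μ := fun n =>
    (integrable_congr (havg n)).1 ((Lp.memLp _).integrable (by norm_num))
  have hbound : ∀ n, ∫ x, |birkhoffAverage ℝ T g n x - c| ∂μ ≤
      ‖birkhoffAverage ℝ U _root_.id n G - P‖ := by
    intro n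
    set F := birkhoffAverage ℝ U _root_.id n G - P
    have h1 : ∫ x, |birkhoffAverage ℝ T g n x - c| ∂μ = ∫ x, ‖F x‖ ∂μ := by
      refine integral_congr_ae ?_
      filter_upwards [Lp.coeFn_sub (birkhoffAverage ℝ U _root_.id n G) P, havg n, hc] with x a b d
      rw [a, Pi.sub_apply, b, d, Real.norm_eq_abs]
      rfl
    rw [h1, integral_norm_eq_lintegral_enorm (Lp.aestronglyMeasurable F), Lp.norm_def,
      ← eLpNorm_one_eq_lintegral_enorm]
    exact ENNReal.toReal_mono (Lp.eLpNorm_ne_top F)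
      (eLpNorm_le_eLpNorm_of_exponent_le (by norm_num) (Lp.aestronglyMeasurable F))
  have hlim0 : Tendsto (fun n : ℕ => ∫ x, |birkhoffAverage ℝ T g n x - c| ∂μ) atTop (𝓝 0) :=
    squeeze_zero (fun n => integral_nonneg fun x => abs_nonneg _) hbound
      (tendsto_iff_norm_sub_tendsto_zero.1 hlim)
  have hgiter : ∀ k : ℕ, ∫ x, g (T^[k] x) ∂μ = ∫ x, g x ∂μ := fun k => by
    have hk := hmp.iterate k
    rw [← integral_map hk.measurable.aemeasurable (by rw [hk.map_eq]; exact hgi.1), hk.map_eq]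
  have hmean : ∀ n : ℕ, 0 < n → ∫ x, birkhoffAverage ℝ T g n x ∂μ = ∫ x, g x ∂μ := by
    intro n hn
    have hn' : (n : ℝ) ≠ 0 := by positivity
    simp only [birkhoffAverage, birkhoffSum, smul_eq_mul]
    have hk : ∀ k ∈ Finset.range n, Integrable (fun x => g (T^[k] x)) μ := fun k _ =>
      (hmp.iterate k).integrable_comp_of_integrable hgi
    rw [integral_const_mul, integral_finsetSum _ hk]
    simp [hgiter, hn']
  -- Every average has integral `∫ g`, and this survives the `L¹` limit.
  have hcg : c = ∫ y, g y ∂μ := by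
    have hle : ∀ᶠ n : ℕ in atTop, |(∫ y, g y ∂μ) - c| ≤
        ∫ x, |birkhoffAverage ℝ T g n x - c| ∂μ := by
      filter_upwards [eventually_gt_atTop 0] with n hn
      have : (∫ y, g y ∂μ) - c = ∫ x, (birkhoffAverage ℝ T g n x - c) ∂μ := by
        rw [integral_sub (hAi n) (integrable_const c), hmean n hn]
        simp
      rw [this]
      exact abs_integral_le_integral_abs
    have := ge_of_tendsto hlim0 hle
    have := abs_nonpos_iff.1 this
    linarith
  rwa [hcg] at hlim0

end MeanErgodic

/-! ### The hot spot principle. -/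

section HotSpot

/-- Shifting an orbit by one step changes its average only by two boundary terms over `N`, and `f`
is bounded. -/
theorem tendsto_average_iterate_sub {X : Type*} [TopologicalSpace X] [CompactSpace X]
    {T : X → X} (x : X) (f : C(X, ℝ)) (k : ℕ) :
    Tendsto (fun N : ℕ => (N : ℝ)⁻¹ * ∑ n ∈ Finset.range N, f (T^[k] (T^[n] x)) -
      (N : ℝ)⁻¹ * ∑ n ∈ Finset.range N, f (T^[n] x)) atTop (𝓝 0) := by
  have hb : Bornology.IsBounded (Set.range f) := (isCompact_range f.continuous).isBounded
  induction k with
  | zero => simp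
  | succ k ih =>
    have h := tendsto_birkhoffAverage_apply_sub_birkhoffAverage ℝ (f := T) (g := f) (x := T^[k] x)
      (hb.subset (by rintro _ ⟨n, rfl⟩; exact ⟨_, rfl⟩))
    refine (h.add ih).congr' (.of_forall fun N => ?_) |>.trans (by simp)
    simp only [birkhoffAverage, birkhoffSum, smul_eq_mul]
    have e : ∀ n, T^[n] (T (T^[k] x)) = T^[k + 1] (T^[n] x) := fun n => by
      rw [← Function.iterate_succ_apply' T k x, ← Function.iterate_add_apply,
        ← Function.iterate_add_apply, Nat.add_comm]
    have e' : ∀ n, T^[n] (T^[k] x) = T^[k] (T^[n] x) := fun n => by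
      rw [← Function.iterate_add_apply, ← Function.iterate_add_apply, Nat.add_comm]
    simp only [e, e']
    ring

variable {X : Type*} [TopologicalSpace X] [MeasurableSpace X] [CompactSpace X]
  [HasOuterApproxClosed X] [OpensMeasurableSpace X]

/-- A dominated orbit of an ergodic map with almost everywhere continuous iterates is generic. -/
theorem IsDominatedSeq.isGenericFor {μ : Measure X} [IsProbabilityMeasure μ] {C : ℝ} (hC : 0 ≤ C)
    {T : X → X} (hT : Ergodic T μ)
    (hcont : ∀ k : ℕ, ∃ D : Set X, IsClosed D ∧ μ D = 0 ∧ ∀ x ∉ D, ContinuousAt T^[k] x)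
    {x : X} (hx : IsDominatedSeq μ C (fun n => T^[n] x)) : IsGenericFor μ T x := by
  intro f
  set c := ∫ y, f y ∂μ
  obtain ⟨B, hB⟩ := (isCompact_range f.continuous).isBounded.exists_norm_le
  have hB' : ∀ y, |f y| ≤ B := fun y => hB _ ⟨y, rfl⟩
  have hfL : MemLp f 2 μ := MemLp.of_bound f.continuous.measurable.aestronglyMeasurable B
    (ae_of_all _ hB')
  rw [Metric.tendsto_atTop']
  refine fun ε hε => eventually_atTop.1 ?_ |>.imp fun N hN n hn => hN n hn.le
  obtain ⟨M, hM0, hM⟩ : ∃ M : ℕ, 0 < M ∧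
      C * ∫ y, |birkhoffAverage ℝ T f M y - c| ∂μ < ε / 3 := by
    have h1 := (hT.tendsto_integral_abs_birkhoffAverage_sub hfL).const_mul C
    rw [mul_zero] at h1
    exact ((eventually_gt_atTop 0).and (h1.eventually_lt_const (by positivity))).exists
  have hM' : (M : ℝ) ≠ 0 := by positivity
  choose D hDc hD0 hDcont using hcont
  have hAb : ∀ y, |birkhoffAverage ℝ T f M y| ≤ B := fun y => by
    simp only [birkhoffAverage, birkhoffSum, smul_eq_mul, abs_mul, abs_inv, Nat.abs_cast]
    calc (M : ℝ)⁻¹ * |∑ k ∈ Finset.range M, f (T^[k] y)| ≤ (M : ℝ)⁻¹ * ∑ k ∈ Finset.range M, B := by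
          gcongr
          exact (Finset.abs_sum_le_sum_abs _ _).trans (Finset.sum_le_sum fun k _ => hB' _)
      _ = B := by simp [hM']
  have hAm : Measurable (birkhoffAverage ℝ T f M) := by
    change Measurable fun y => (M : ℝ)⁻¹ * ∑ k ∈ Finset.range M, f (T^[k] y)
    refine Measurable.const_mul (Finset.measurable_fun_sum _ fun k _ => ?_) _
    exact f.continuous.measurable.comp (hT.measurable.iterate k)
  have hdom := hx.eventually_le hC (D := ⋃ k ∈ Finset.range M, D k)
    (h := fun y => |birkhoffAverage ℝ T f M y - c|) (B := B + |c|)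
    (isClosed_biUnion_finset fun k _ => hDc k)
    ((measure_biUnion_null_iff (Finset.countable_toSet _)).2 fun k _ => hD0 k)
    (Integrable.of_bound (C := B + |c|) (by fun_prop) (ae_of_all _ fun y => by
      rw [Real.norm_eq_abs, abs_abs]
      exact (abs_sub _ _).trans (add_le_add (hAb y) le_rfl)))
    (fun y => abs_nonneg _)
    (fun y => (abs_sub _ _).trans (add_le_add (hAb y) le_rfl))
    (fun y hy => by
      simp only [Set.mem_iUnion, not_exists] at hy
      change ContinuousAt
        (fun y => |(M : ℝ)⁻¹ * ∑ k ∈ Finset.range M, f (T^[k] y) - c|) y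
      refine ((continuousAt_const.mul (tendsto_finsetSum _ fun k hk => ?_)).sub
        continuousAt_const).abs
      exact (f.continuous.continuousAt.comp (hDcont k y (hy k hk))))
    (show 0 < ε / 3 by positivity)
  have hshift : Tendsto (fun N : ℕ => (M : ℝ)⁻¹ * ∑ k ∈ Finset.range M,
      ((N : ℝ)⁻¹ * ∑ n ∈ Finset.range N, f (T^[k] (T^[n] x)) -
      (N : ℝ)⁻¹ * ∑ n ∈ Finset.range N, f (T^[n] x))) atTop (𝓝 0) := by
    simpa using (tendsto_finsetSum (Finset.range M) fun k _ =>
      tendsto_average_iterate_sub (T := T) x f k).const_mul (M : ℝ)⁻¹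
  filter_upwards [hdom, (Metric.tendsto_nhds.1 hshift) (ε / 3) (by positivity),
    eventually_gt_atTop 0] with N h1 h2 hN
  have hN' : (N : ℝ) ≠ 0 := by positivity
  -- Exchange the averages over `n < N` and `k < M`; only the shift errors separate the double
  -- average from the plain one.
  have key : (N : ℝ)⁻¹ * ∑ n ∈ Finset.range N, (birkhoffAverage ℝ T f M (T^[n] x) - c) =
      (M : ℝ)⁻¹ * ∑ k ∈ Finset.range M,
      ((N : ℝ)⁻¹ * ∑ n ∈ Finset.range N, f (T^[k] (T^[n] x)) -
      (N : ℝ)⁻¹ * ∑ n ∈ Finset.range N, f (T^[n] x)) + (birkhoffAverage ℝ T f N x - c) := by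
    simp only [birkhoffAverage, birkhoffSum, smul_eq_mul, Finset.sum_sub_distrib, mul_sub,
      ← Finset.mul_sum, Finset.sum_const, Finset.card_range, nsmul_eq_mul,
      inv_mul_cancel_left₀ hN']
    rw [Finset.sum_comm]
    field_simp
    ring
  have h3 : |(N : ℝ)⁻¹ * ∑ n ∈ Finset.range N, (birkhoffAverage ℝ T f M (T^[n] x) - c)| ≤
      (N : ℝ)⁻¹ * ∑ n ∈ Finset.range N, |birkhoffAverage ℝ T f M (T^[n] x) - c| := by
    rw [abs_mul, abs_inv, Nat.abs_cast]
    gcongr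
    exact Finset.abs_sum_le_sum_abs _ _
  rw [Real.dist_eq, sub_zero] at h2
  rw [Real.dist_eq]
  have h4 : birkhoffAverage ℝ T f N x - c =
      (N : ℝ)⁻¹ * ∑ n ∈ Finset.range N, (birkhoffAverage ℝ T f M (T^[n] x) - c) -
      (M : ℝ)⁻¹ * ∑ k ∈ Finset.range M,
      ((N : ℝ)⁻¹ * ∑ n ∈ Finset.range N, f (T^[k] (T^[n] x)) -
      (N : ℝ)⁻¹ * ∑ n ∈ Finset.range N, f (T^[n] x)) := by rw [key]; ring
  rw [h4]
  refine (abs_sub _ _).trans_lt ?_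
  linarith

end HotSpot

/-! ### Change of variables along affine branches. -/

section UnitIntervalIntegral

theorem unitInterval.integral_eq_intervalIntegral (H : ℝ → ℝ) :
    ∫ x : unitInterval, H x = ∫ x in (0 : ℝ)..1, H x := by
  rw [intervalIntegral.integral_of_le zero_le_one, ← integral_Icc_eq_integral_Ioc]
  exact (unitInterval.measurePreserving_coe.integral_comp
    unitInterval.measurableEmbedding_coe H)

/-- The affine map of `[0,1]` onto `[i/r, (i+1)/r]`, increasing if `a = 0` and decreasing if
`a = 1`. -/
noncomputable def affineBranch {r : ℕ} (i : Fin r) (a : Fin 2) (y : unitInterval) : unitInterval :=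
  ⟨((i : ℝ) + (if a = 0 then y else unitInterval.symm y : unitInterval)) / r, by
    have h0 := (if a = 0 then y else unitInterval.symm y : unitInterval).2.1
    positivity, by
    have h1 := (if a = 0 then y else unitInterval.symm y : unitInterval).2.2
    have hi : ((i : ℕ) : ℝ) + 1 ≤ r := by exact_mod_cast i.2
    have : (0 : ℝ) < r := by have := i.pos; positivity
    rw [div_le_one this]
    linarith⟩

theorem continuous_affineBranch {r : ℕ} (i : Fin r) (a : Fin 2) :
    Continuous (affineBranch i a) := by
  unfold affineBranch
  fin_cases a <;> simp <;> fun_prop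

/-- Reflection preserves Lebesgue measure, so the orientation `a` is irrelevant and only a scaling
by `r` remains. `Set.projIcc` extends `h` to the line. -/
theorem integral_affineBranch {r : ℕ} (i : Fin r) (a : Fin 2) (h : unitInterval → ℝ) :
    ∫ y, h (affineBranch i a y) =
      r * ∫ x in (i : ℝ) / r..((i + 1 : ℕ) : ℝ) / r, h (Set.projIcc 0 1 zero_le_one x) := by
  have hr : (r : ℝ) ≠ 0 := by have := i.pos; positivity
  have h0 : ∫ y, h (affineBranch i a y) = ∫ y, h (affineBranch i 0 y) := by
    by_cases ha : a = 0
    · rw [ha]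
    · rw [← unitInterval.measurePreserving_symm.integral_comp
        (unitInterval.symmMeasurableEquiv.measurableEmbedding) (fun y => h (affineBranch i 0 y))]
      simp [affineBranch, ha]
  have h1 : ∀ y : unitInterval, h (affineBranch i 0 y) =
      (fun y : ℝ => h (Set.projIcc 0 1 zero_le_one (y / r + i / r))) y := fun y => by
    have : affineBranch i 0 y = Set.projIcc 0 1 zero_le_one ((y : ℝ) / r + i / r) := by
      rw [← Set.projIcc_val zero_le_one (affineBranch i 0 y)]
      congr 1
      simp [affineBranch]
      ring
    rw [this]
  rw [h0, integral_congr_ae (ae_of_all _ h1), unitInterval.integral_eq_intervalIntegral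
      (fun y : ℝ => h (Set.projIcc 0 1 zero_le_one (y / r + i / r))),
    intervalIntegral.integral_comp_div_add (fun x => h (Set.projIcc 0 1 zero_le_one x)) hr]
  simp only [smul_eq_mul]
  congr 2 <;> push_cast <;> ring

theorem integral_eq_sum_integral_affineBranch {r : ℕ} (hr : 0 < r) (s : Fin r → Fin 2)
    {h : unitInterval → ℝ} (hm : Measurable h) {B : ℝ} (hB : ∀ x, |h x| ≤ B) :
    ∫ x, h x = (r : ℝ)⁻¹ * ∑ i, ∫ y, h (affineBranch i (s i) y) := by
  have hr' : (r : ℝ) ≠ 0 := by positivity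
  have h0 : ∫ x, h x = ∫ x in (0 : ℝ)..1, h (Set.projIcc 0 1 zero_le_one x) := by
    rw [← unitInterval.integral_eq_intervalIntegral]
    simp
  have hii : ∀ a b : ℝ, IntervalIntegrable (fun x => h (Set.projIcc 0 1 zero_le_one x))
      volume a b := fun a b => by
    refine (intervalIntegrable_const (c := B)).mono_fun ?_ (ae_of_all _ fun x => ?_)
    · exact (hm.comp continuous_projIcc.measurable).aestronglyMeasurable
    · exact (hB _).trans (le_abs_self B)
  have h1 := intervalIntegral.sum_integral_adjacent_intervals (a := fun k : ℕ => (k : ℝ) / r)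
    (n := r) (fun k _ => hii _ _)
  simp only [Nat.cast_zero, zero_div, div_self hr'] at h1
  rw [h0, ← h1, ← Fin.sum_univ_eq_sum_range (fun k : ℕ => ∫ x in (k : ℝ) / r..((k + 1 : ℕ) : ℝ) / r,
    h (Set.projIcc 0 1 zero_le_one x))]
  simp only [integral_affineBranch, ← Finset.mul_sum]
  rw [inv_mul_cancel_left₀ hr']

end UnitIntervalIntegral

/-! ### Flipped maps: transfer operator, ergodicity, continuity of iterates. -/

section FlippedMap

variable {r : ℕ} {s : Fin r → Fin 2}

theorem flippedMap_eq_of_floor_eq {i : Fin r} {x : unitInterval}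
    (h : ⌊(r : ℝ) * x⌋₊ = i) :
    (flippedMap r s x : ℝ) = if s i = 0 then Int.fract ((r : ℝ) * x)
      else 1 - Int.fract ((r : ℝ) * x) := by
  have hlt : ⌊(r : ℝ) * x⌋₊ < r := h ▸ i.2
  have hi : (⟨⌊(r : ℝ) * x⌋₊, hlt⟩ : Fin r) = i := Fin.ext h
  change flippedValue r s x = _
  rw [flippedValue, dif_pos hlt, hi]
  generalize s i = a
  fin_cases a
  · simp
  · simp [sub_eq_add_neg]

theorem flippedMap_one : flippedMap r s 1 = 0 := by
  ext
  change flippedValue r s 1 = 0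
  simp [flippedValue]

theorem flippedMap_eq_or (hr : 0 < r) (x : unitInterval) :
    (flippedMap r s x : ℝ) = Int.fract ((r : ℝ) * x) ∨
      (flippedMap r s x : ℝ) = 1 - Int.fract ((r : ℝ) * x) := by
  by_cases h : ⌊(r : ℝ) * x⌋₊ < r
  · rw [flippedMap_eq_of_floor_eq (i := ⟨_, h⟩) rfl]
    split_ifs <;> simp
  · left
    have hr' : (0 : ℝ) < r := by positivity
    have h1 : (r : ℝ) ≤ r * x := (Nat.le_floor_iff (mul_nonneg hr'.le x.2.1)).1 (not_lt.1 h)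
    have h2 : x = 1 := le_antisymm x.2.2 (Subtype.coe_le_coe.1
      (by simpa using le_of_mul_le_mul_left (by simpa using h1) hr'))
    rw [h2, flippedMap_one]
    simp

theorem flippedMap_zero_flips (hr : 0 < r) (x : unitInterval) :
    (flippedMap r 0 x : ℝ) = Int.fract ((r : ℝ) * x) := by
  by_cases h : ⌊(r : ℝ) * x⌋₊ < r
  · rw [flippedMap_eq_of_floor_eq (i := ⟨_, h⟩) rfl]
    simp
  · have hr' : (0 : ℝ) < r := by positivity
    have h1 : (r : ℝ) ≤ r * x := (Nat.le_floor_iff (mul_nonneg hr'.le x.2.1)).1 (not_lt.1 h)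
    have h2 : x = 1 := le_antisymm x.2.2 (Subtype.coe_le_coe.1
      (by simpa using le_of_mul_le_mul_left (by simpa using h1) hr'))
    rw [h2, flippedMap_one]
    simp

theorem measurable_flippedMap : Measurable (flippedMap r s) := by
  refine Measurable.subtype_mk ?_
  let c : ℕ → ℝ := fun n => if h : n < r then ((s ⟨n, h⟩ : ℕ) : ℝ) else 0
  let d : ℕ → ℝ := fun n => if h : n < r then (-1 : ℝ) ^ (s ⟨n, h⟩ : ℕ) else 0
  have h1 : (fun x : unitInterval => flippedValue r s x) = fun x : unitInterval =>
      c ⌊(r : ℝ) * x⌋₊ + d ⌊(r : ℝ) * x⌋₊ * Int.fract ((r : ℝ) * x) := by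
    funext x
    simp only [flippedValue, c, d]
    split_ifs <;> simp
  rw [h1]
  have hf : Measurable fun x : unitInterval => ⌊(r : ℝ) * x⌋₊ :=
    Nat.measurable_floor.comp (by fun_prop)
  have hc : Measurable c := measurable_from_top
  have hd : Measurable d := measurable_from_top
  exact (hc.comp hf).add ((hd.comp hf).mul (measurable_fract.comp (by fun_prop)))

/-- The endpoints are excluded because one of them, depending on `s i`, is sent to `(i + 1) / r`,
which lies outside the half-open branch interval. -/
theorem flippedMap_affineBranch (i : Fin r) {y : unitInterval} (hy0 : y ≠ 0) (hy1 : y ≠ 1) :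
    flippedMap r s (affineBranch i (s i) y) = y := by
  have hr : (r : ℝ) ≠ 0 := by have := i.pos; positivity
  set z : unitInterval := if s i = 0 then y else unitInterval.symm y with hz
  have hz1 : (z : ℝ) < 1 := by
    rw [hz]
    split_ifs
    · exact unitInterval.lt_one_iff_ne_one.2 hy1
    · have : (0 : ℝ) < y := unitInterval.pos_iff_ne_zero.2 hy0
      simpa using this
  have h1 : (r : ℝ) * (affineBranch i (s i) y : unitInterval) = (i : ℕ) + (z : ℝ) := by
    simp only [affineBranch, ← hz]
    field_simp
  have hfl : ⌊(r : ℝ) * (affineBranch i (s i) y : unitInterval)⌋₊ = i := by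
    rw [h1, Nat.floor_eq_iff (add_nonneg (Nat.cast_nonneg _) z.2.1)]
    constructor <;> linarith [z.2.1]
  have hfr : Int.fract ((r : ℝ) * (affineBranch i (s i) y : unitInterval)) = z := by
    rw [h1, Int.fract_natCast_add, Int.fract_eq_self.2 ⟨z.2.1, hz1⟩]
  ext
  rw [flippedMap_eq_of_floor_eq hfl, hfr, hz]
  split_ifs <;> simp

/-- The transfer operator of the flipped base-`r` map. -/
noncomputable def flippedTransfer (r : ℕ) (s : Fin r → Fin 2) (g : C(unitInterval, ℝ)) :
    C(unitInterval, ℝ) where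
  toFun y := (r : ℝ)⁻¹ * ∑ i, g (affineBranch i (s i) y)
  continuous_toFun := continuous_const.mul
    (continuous_finsetSum _ fun i _ => g.continuous.comp (continuous_affineBranch i (s i)))

/-- Duality of composition and transfer: cut `[0,1]` into branch intervals and change variables,
using that each branch is almost everywhere a right inverse of the map. -/
theorem integral_comp_flippedMap_mul (hr : 0 < r) {h : unitInterval → ℝ} (hm : Measurable h)
    {B : ℝ} (hB : ∀ x, |h x| ≤ B) (g : C(unitInterval, ℝ)) :
    ∫ x, h (flippedMap r s x) * g x = ∫ x, h x * flippedTransfer r s g x := by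
  obtain ⟨K, hK⟩ := (isCompact_range g.continuous).isBounded.exists_norm_le
  have hb : ∀ x y, |h x * g y| ≤ B * K := fun x y => by
    rw [abs_mul]
    exact mul_le_mul (hB x) (hK _ ⟨y, rfl⟩) (abs_nonneg _) ((abs_nonneg _).trans (hB x))
  rw [integral_eq_sum_integral_affineBranch hr s (h := fun x => h (flippedMap r s x) * g x)
    ((hm.comp measurable_flippedMap).mul g.continuous.measurable) (fun x => hb _ _)]
  have h1 : ∀ i : Fin r, ∫ y, h (flippedMap r s (affineBranch i (s i) y)) *
      g (affineBranch i (s i) y) = ∫ y, h y * g (affineBranch i (s i) y) := fun i => by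
    refine integral_congr_ae ?_
    filter_upwards [measure_eq_zero_iff_ae_notMem.1 (measure_singleton (μ := volume)
      (0 : unitInterval)), measure_eq_zero_iff_ae_notMem.1 (measure_singleton (μ := volume)
      (1 : unitInterval))] with y hy0 hy1
    rw [flippedMap_affineBranch i hy0 hy1]
  rw [Finset.sum_congr rfl fun i _ => h1 i, ← integral_finsetSum, ← integral_const_mul]
  · refine integral_congr_ae (ae_of_all _ fun y => ?_)
    simp only [flippedTransfer, ContinuousMap.coe_mk, ← Finset.mul_sum]
    ring
  · intro i _
    exact Integrable.of_bound (hm.mul ((g.continuous.comp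
      (continuous_affineBranch i (s i))).measurable)).aestronglyMeasurable (B * K)
      (ae_of_all _ fun y => hb _ _)

theorem abs_indicator_one_le {X : Type*} (A : Set X) (x : X) :
    |A.indicator (fun _ => (1 : ℝ)) x| ≤ 1 := by
  by_cases h : x ∈ A <;> simp [h]

theorem abs_integral_le_of_forall_abs_le {X : Type*} [MeasurableSpace X] {μ : Measure X}
    [IsProbabilityMeasure μ] {f : X → ℝ} {ε : ℝ} (h : ∀ x, |f x| ≤ ε) : |∫ x, f x ∂μ| ≤ ε := by
  have := norm_integral_le_of_norm_le_const (μ := μ) (f := f) (C := ε) (ae_of_all _ h)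
  rwa [probReal_univ, mul_one] at this

theorem measurePreserving_flippedMap (hr : 0 < r) :
    MeasurePreserving (flippedMap r s) volume volume := by
  refine ⟨measurable_flippedMap, Measure.ext fun A hA => ?_⟩
  rw [Measure.map_apply measurable_flippedMap hA]
  have h := integral_comp_flippedMap_mul (s := s) hr
    (measurable_const.indicator hA) (abs_indicator_one_le A) 1
  have hP : flippedTransfer r s 1 = 1 := by
    ext y
    have : (r : ℝ) ≠ 0 := by positivity
    simp [flippedTransfer, this]
  simp only [hP, ContinuousMap.one_apply, mul_one] at h
  have h2 : (fun x => A.indicator (fun _ => (1 : ℝ)) (flippedMap r s x)) =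
      (flippedMap r s ⁻¹' A).indicator fun _ => (1 : ℝ) := rfl
  rw [h2, integral_indicator_const _ (measurable_flippedMap hA), integral_indicator_const _ hA,
    smul_eq_mul, smul_eq_mul, mul_one, mul_one] at h
  exact (ENNReal.toReal_eq_toReal_iff' (measure_ne_top _ _) (measure_ne_top _ _)).1 h

theorem integral_flippedTransfer (hr : 0 < r) (g : C(unitInterval, ℝ)) :
    ∫ x, flippedTransfer r s g x = ∫ x, g x := by
  simpa using (integral_comp_flippedMap_mul (s := s) hr (h := fun _ => 1) measurable_const
    (B := 1) (fun _ => by simp) g).symm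

/-- Each branch contracts by `1 / r`, so the modulus of continuity improves from scale `δ` to scale
`r * δ`. -/
theorem abs_flippedTransfer_sub_le (hr : 0 < r) {g : C(unitInterval, ℝ)} {δ ε : ℝ}
    (hg : ∀ x y : unitInterval, |(x : ℝ) - y| ≤ δ → |g x - g y| ≤ ε) (x y : unitInterval)
    (hxy : |(x : ℝ) - y| ≤ r * δ) :
    |flippedTransfer r s g x - flippedTransfer r s g y| ≤ ε := by
  have hr' : (0 : ℝ) < r := by positivity
  have h1 : ∀ i : Fin r, |g (affineBranch i (s i) x) - g (affineBranch i (s i) y)| ≤ ε := by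
    intro i
    apply hg
    have : |(affineBranch i (s i) x : ℝ) - affineBranch i (s i) y| = |(x : ℝ) - y| / r := by
      rw [← Nat.abs_cast r, ← abs_div]
      simp only [affineBranch]
      split_ifs
      · congr 1; ring
      · rw [← abs_neg]; congr 1; simp only [unitInterval.coe_symm_eq]; ring
    rw [this, div_le_iff₀' hr']
    exact hxy
  simp only [flippedTransfer, ContinuousMap.coe_mk, ← mul_sub, ← Finset.sum_sub_distrib]
  rw [abs_mul, abs_inv, Nat.abs_cast]
  calc (r : ℝ)⁻¹ * |∑ i, (g (affineBranch i (s i) x) - g (affineBranch i (s i) y))|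
      ≤ (r : ℝ)⁻¹ * ∑ i : Fin r, ε := by
        gcongr
        exact (Finset.abs_sum_le_sum_abs _ _).trans (Finset.sum_le_sum fun i _ => h1 i)
    _ = ε := by simp [hr'.ne']

/-- Once `r ^ n * (δ / 2) ≥ 1`, the oscillation of the iterate over all of `[0,1]` is at most `ε`,
while its integral has not changed. -/
theorem exists_flippedTransfer_iterate_close (hr : 1 < r) (g : C(unitInterval, ℝ)) {ε : ℝ}
    (hε : 0 < ε) : ∃ n : ℕ, ∀ x, |(flippedTransfer r s)^[n] g x - ∫ y, g y| ≤ ε := by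
  have hr0 : 0 < r := by lia
  obtain ⟨δ, hδ, hg⟩ := Metric.uniformContinuous_iff.1
    (CompactSpace.uniformContinuous_of_continuous g.continuous) ε hε
  have h1 : ∀ n : ℕ, ∀ x y : unitInterval, |(x : ℝ) - y| ≤ (r : ℝ) ^ n * (δ / 2) →
      |(flippedTransfer r s)^[n] g x - (flippedTransfer r s)^[n] g y| ≤ ε := by
    intro n
    induction n with
    | zero =>
      intro x y hxy
      refine (hg ?_).le
      rw [Subtype.dist_eq, Real.dist_eq]
      linarith
    | succ n ih =>
      intro x y hxy
      rw [Function.iterate_succ_apply']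
      exact abs_flippedTransfer_sub_le hr0 ih x y (by rwa [← mul_assoc, ← pow_succ'])
  have h2 : ∀ n : ℕ, ∫ x, (flippedTransfer r s)^[n] g x = ∫ x, g x := by
    intro n
    induction n with
    | zero => rfl
    | succ n ih => rw [Function.iterate_succ_apply', integral_flippedTransfer hr0, ih]
  obtain ⟨n, hn⟩ := pow_unbounded_of_one_lt (1 / (δ / 2)) (show (1 : ℝ) < r by exact_mod_cast hr)
  rw [div_lt_iff₀ (half_pos hδ)] at hn
  refine ⟨n, fun x => ?_⟩
  set G := (flippedTransfer r s)^[n] g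
  have hGi := G.integrable_of_isFiniteMeasure volume
  have h3 : G x - ∫ y, g y = ∫ y, (G x - G y) := by
    rw [integral_sub (integrable_const _) hGi, h2]
    simp
  rw [h3]
  refine abs_integral_le_of_forall_abs_le fun y => ?_
  refine h1 n x y (le_trans ?_ hn.le)
  rw [abs_le]
  constructor <;> linarith [x.2.1, x.2.2, y.2.1, y.2.2]

theorem ergodic_flippedMap (hr : 1 < r) (s : Fin r → Fin 2) :
    Ergodic (flippedMap r s) volume := by
  have hr0 : 0 < r := by lia
  refine ⟨measurePreserving_flippedMap hr0, ⟨fun A hA hinv => ?_⟩⟩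
  set χ : unitInterval → ℝ := A.indicator fun _ => 1 with hχ
  have hχm : Measurable χ := measurable_const.indicator hA
  have hχT : ∀ x, χ (flippedMap r s x) = χ x := fun x => by
    change (flippedMap r s ⁻¹' A).indicator (fun _ => (1 : ℝ)) x = _
    rw [hinv]
  have hiter : ∀ (n : ℕ) (g : C(unitInterval, ℝ)),
      ∫ x, χ x * (flippedTransfer r s)^[n] g x = ∫ x, χ x * g x := by
    intro n
    induction n with
    | zero => intro g; rfl
    | succ n ih =>
      intro g
      rw [Function.iterate_succ_apply', ← integral_comp_flippedMap_mul hr0 hχm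
        (abs_indicator_one_le A), ← ih]
      simp only [hχT]
  -- By duality and invariance of `A`, `g` may be replaced by its flattened iterates: `A` is
  -- independent of every continuous function.
  have hind : ∀ g : C(unitInterval, ℝ), ∫ x, χ x * g x = volume.real A * ∫ x, g x := by
    intro g
    refine eq_of_forall_dist_le fun ε hε => ?_
    rw [Real.dist_eq]
    obtain ⟨n, hn⟩ := exists_flippedTransfer_iterate_close (s := s) hr g hε
    have hχi : Integrable χ := (integrable_const (1 : ℝ)).indicator hA
    have h1 : (∫ x, χ x * g x) - volume.real A * ∫ x, g x =
        ∫ x, χ x * ((flippedTransfer r s)^[n] g x - ∫ y, g y) := by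
      simp only [mul_sub]
      rw [integral_sub, hiter, integral_mul_const, hχ, integral_indicator_const _ hA]
      · simp
      · exact (((flippedTransfer r s)^[n] g).integrable_of_isFiniteMeasure volume).bdd_mul
          hχm.aestronglyMeasurable (ae_of_all _ (abs_indicator_one_le A))
      · exact hχi.mul_const _
    rw [h1]
    refine abs_integral_le_of_forall_abs_le fun y => ?_
    rw [abs_mul]
    exact (mul_le_of_le_one_left (abs_nonneg _) (abs_indicator_one_le A y)).trans (hn y)
  have hmeas : volume.restrict A = volume A • (volume : Measure unitInterval) := by
    have : IsFiniteMeasure (volume A • (volume : Measure unitInterval)) :=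
      Measure.smul_finite _ (measure_ne_top _ _)
    refine ext_of_forall_integral_eq_of_IsFiniteMeasure fun f => ?_
    have := hind f.toContinuousMap
    rw [integral_smul_measure, smul_eq_mul]
    refine Eq.trans ?_ this
    rw [← integral_indicator hA]
    refine integral_congr_ae (ae_of_all _ fun x => ?_)
    by_cases hx : x ∈ A <;> simp [hχ, hx]
  -- Evaluating at `A` itself gives `λ(A) = λ(A) ^ 2`.
  have hsq := congrArg (fun μ : Measure unitInterval => μ A) hmeas
  simp only [Measure.restrict_apply hA, Set.inter_self, Measure.smul_apply, smul_eq_mul] at hsq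
  rw [eventuallyConst_set']
  rcases eq_or_ne (volume A) 0 with h0 | h0
  · left
    exact ae_eq_empty.2 h0
  · right
    rw [ae_eq_univ, prob_compl_eq_zero_iff hA]
    have : volume A * 1 = volume A * volume A := by rw [mul_one]; exact hsq
    exact ((ENNReal.mul_right_inj h0 (measure_ne_top _ _)).1 this).symm

theorem isClosed_setOf_mul_eq_intCast (a : ℝ) :
    IsClosed {x : unitInterval | ∃ n : ℤ, a * x = n} := by
  have h : {x : unitInterval | ∃ n : ℤ, a * x = n} =
      (fun x : unitInterval => a * (x : ℝ)) ⁻¹' Set.range ((↑) : ℤ → ℝ) := by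
    ext x
    simp [eq_comm]
  rw [h]
  exact Int.isClosedEmbedding_coe_real.isClosed_range.preimage (by fun_prop)

theorem volume_setOf_mul_eq_intCast {a : ℝ} (ha : a ≠ 0) :
    volume {x : unitInterval | ∃ n : ℤ, a * x = n} = 0 := by
  have h : {x : unitInterval | ∃ n : ℤ, a * x = n} =
      (fun x : unitInterval => a * (x : ℝ)) ⁻¹' Set.range ((↑) : ℤ → ℝ) := by
    ext x
    simp [eq_comm]
  rw [h]
  refine Set.Countable.measure_zero ((Set.countable_range _).preimage_of_injOn ?_) _
  intro x _ y _ hxy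
  exact Subtype.ext (mul_left_cancel₀ ha hxy)

theorem continuousAt_flippedMap {x : unitInterval} (hx : ¬ ∃ n : ℤ, (r : ℝ) * x = n) :
    ContinuousAt (flippedMap r s) x := by
  have hx0 : 0 ≤ (r : ℝ) * x := mul_nonneg (Nat.cast_nonneg _) x.2.1
  set n := ⌊(r : ℝ) * x⌋₊
  have h1 : (n : ℝ) < r * x := lt_of_le_of_ne (Nat.floor_le hx0) fun h => hx ⟨n, by simp [h]⟩
  have h2 : (r : ℝ) * x < n + 1 := Nat.lt_floor_add_one _
  have hev : ∀ᶠ y : unitInterval in 𝓝 x, (n : ℝ) < r * y ∧ (r : ℝ) * y < n + 1 := by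
    have hc : Continuous fun y : unitInterval => (r : ℝ) * y := by fun_prop
    exact (hc.tendsto x).eventually (Ioo_mem_nhds h1 h2)
  have hnr : n < r := by
    have : (n : ℝ) < r := h1.trans_le (mul_le_of_le_one_right (Nat.cast_nonneg _) x.2.2)
    exact_mod_cast this
  have heq : (fun y => (flippedMap r s y : ℝ)) =ᶠ[𝓝 x] fun y : unitInterval =>
      if s ⟨n, hnr⟩ = 0 then (r : ℝ) * y - n else 1 - ((r : ℝ) * y - n) := by
    filter_upwards [hev] with y hy
    have hf : ⌊(r : ℝ) * y⌋₊ = n :=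
      (Nat.floor_eq_iff (mul_nonneg (Nat.cast_nonneg _) y.2.1)).2 ⟨hy.1.le, hy.2⟩
    have hfr : Int.fract ((r : ℝ) * y) = (r : ℝ) * y - n :=
      Int.fract_eq_iff.2 ⟨by linarith, by linarith, n, by simp⟩
    rw [flippedMap_eq_of_floor_eq (i := ⟨n, hnr⟩) hf, hfr]
  rw [Topology.IsInducing.subtypeVal.continuousAt_iff]
  refine ContinuousAt.congr ?_ heq.symm
  split_ifs <;> fun_prop

/-- The map is `± r * x` modulo `1`, so an integrality condition on the image at level `k` pulls
back to level `k + 1`. -/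
theorem continuousAt_flippedMap_iterate (hr : 0 < r) (k : ℕ) {x : unitInterval}
    (hx : ¬ ∃ n : ℤ, (r : ℝ) ^ k * x = n) : ContinuousAt (flippedMap r s)^[k] x := by
  induction k generalizing x with
  | zero => exact continuousAt_id
  | succ k ih =>
    rw [Function.iterate_succ]
    refine ContinuousAt.comp (ih ?_) (continuousAt_flippedMap ?_)
    · rintro ⟨n, hn⟩
      rcases flippedMap_eq_or (s := s) hr x with h | h <;> rw [h, Int.fract] at hn
      · refine hx ⟨n + r ^ k * ⌊(r : ℝ) * x⌋, ?_⟩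
        push_cast
        rw [← hn]
        ring
      · refine hx ⟨r ^ k + r ^ k * ⌊(r : ℝ) * x⌋ - n, ?_⟩
        push_cast
        rw [← hn]
        ring
    · rintro ⟨n, hn⟩
      refine hx ⟨r ^ k * n, ?_⟩
      push_cast
      rw [← hn]
      ring

theorem IsDominatedSeq.isGenericFor_flippedMap (hr : 1 < r) {C : ℝ} (hC : 0 ≤ C)
    {x : unitInterval} (hx : IsDominatedSeq volume C fun n => (flippedMap r s)^[n] x) :
    IsGenericFor volume (flippedMap r s) x :=
  hx.isGenericFor hC (ergodic_flippedMap hr s) fun k =>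
    ⟨_, isClosed_setOf_mul_eq_intCast ((r : ℝ) ^ k),
      volume_setOf_mul_eq_intCast (by positivity), fun _ hy =>
      continuousAt_flippedMap_iterate (by lia) k hy⟩

end FlippedMap

/-! ### Independence of the flips. -/

section FlipEquivalence

variable {r : ℕ}

/-- Up to the reflection of `[0,1]`, the image of a point under a flipped map does not depend on
the flips, and only depends on the point up to reflection. -/
theorem flippedMap_eq_or_eq_symm (hr : 0 < r) (s t : Fin r → Fin 2) {x y : unitInterval}
    (h : y = x ∨ y = unitInterval.symm x) :
    flippedMap r t y = flippedMap r s x ∨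
      flippedMap r t y = unitInterval.symm (flippedMap r s x) := by
  have hfr : Int.fract ((r : ℝ) * y) = Int.fract ((r : ℝ) * x) ∨
      Int.fract ((r : ℝ) * y) = 1 - Int.fract ((r : ℝ) * x) := by
    rcases h with rfl | rfl
    · exact Or.inl rfl
    · have e : (r : ℝ) * (unitInterval.symm x : unitInterval) = (r : ℕ) + -((r : ℝ) * x) := by
        rw [unitInterval.coe_symm_eq]; ring
      rw [e, Int.fract_natCast_add]
      by_cases h0 : Int.fract ((r : ℝ) * x) = 0
      · left; rw [h0]; exact Int.fract_neg_eq_zero.2 h0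
      · right; exact Int.fract_neg h0
  simp only [Subtype.ext_iff, unitInterval.coe_symm_eq]
  rcases flippedMap_eq_or (s := s) hr x with h1 | h1 <;>
  rcases flippedMap_eq_or (s := t) hr y with h2 | h2 <;>
  rcases hfr with h3 | h3 <;> rw [h1, h2, h3] <;> simp

theorem flippedMap_iterate_eq_or_eq_symm (hr : 0 < r) (s t : Fin r → Fin 2) (x : unitInterval)
    (n : ℕ) : (flippedMap r t)^[n] x = (flippedMap r s)^[n] x ∨
      (flippedMap r t)^[n] x = unitInterval.symm ((flippedMap r s)^[n] x) := by
  induction n with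
  | zero => exact Or.inl rfl
  | succ n ih =>
    simp only [Function.iterate_succ_apply']
    exact flippedMap_eq_or_eq_symm hr s t ih

/-- Whichever of the two reflected points occurs, `f` there is at most `f + f ∘ symm` at the known
orbit point, and this function has integral `2 * ∫ f`. -/
theorem IsGenericFor.flippedMap_of_flips (hr : 1 < r) {s : Fin r → Fin 2} (t : Fin r → Fin 2)
    {x : unitInterval} (hx : IsGenericFor volume (flippedMap r s) x) :
    IsGenericFor volume (flippedMap r t) x := by
  refine IsDominatedSeq.isGenericFor_flippedMap hr (C := 2) zero_le_two fun f hf ε hε => ?_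
  let g : C(unitInterval, ℝ) := f + f.comp ⟨unitInterval.symm, unitInterval.continuous_symm⟩
  have hg : ∫ y, g y = 2 * ∫ y, f y := by
    have h1 : ∫ y, f (unitInterval.symm y) = ∫ y, f y :=
      unitInterval.measurePreserving_symm.integral_comp
        unitInterval.symmMeasurableEquiv.measurableEmbedding f
    have h2 : Integrable fun y => f (unitInterval.symm y) :=
      (f.comp ⟨unitInterval.symm, unitInterval.continuous_symm⟩).integrable_of_isFiniteMeasure
        volume
    change ∫ y, (f y + f (unitInterval.symm y)) = _
    rw [integral_add (f.integrable_of_isFiniteMeasure volume) h2, h1]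
    ring
  filter_upwards [hx.isDominatedSeq g (fun y => add_nonneg (hf _) (hf _)) ε hε] with N hN
  rw [one_mul, hg] at hN
  refine le_trans ?_ hN
  gcongr with n _
  change _ ≤ f _ + f (unitInterval.symm _)
  rcases flippedMap_iterate_eq_or_eq_symm (by lia) s t x n with h | h <;> rw [h]
  · exact le_add_of_nonneg_right (hf _)
  · exact le_add_of_nonneg_left (hf _)

end FlipEquivalence

/-! ### Iterates and multiplicatively dependent bases. -/

section Iterate

theorem Finset.sum_range_mul_eq_sum_sum {M : Type*} [AddCommMonoid M] (a : ℕ → M) (k N : ℕ) :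
    ∑ m ∈ Finset.range (k * N), a m =
      ∑ n ∈ Finset.range N, ∑ j ∈ Finset.range k, a (k * n + j) := by
  induction N with
  | zero => simp
  | succ N ih => rw [Nat.mul_succ, Finset.sum_range_add, ih, Finset.sum_range_succ]

/-- Every `k`-th orbit point is kept and the other nonnegative terms are dropped; renormalising
costs the factor `k`. -/
theorem IsGenericFor.isDominatedSeq_iterate {X : Type*} [TopologicalSpace X] [MeasurableSpace X]
    {μ : Measure X} {T : X → X} {x : X} (hx : IsGenericFor μ T x) {k : ℕ} (hk : 0 < k) :
    IsDominatedSeq μ k (fun n => (T^[k])^[n] x) := by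
  intro f hf ε hε
  have hk' : (0 : ℝ) < k := by positivity
  have h := (tendsto_id.const_mul_atTop' hk : Tendsto (fun N : ℕ => k * N) atTop atTop).eventually
    (hx.isDominatedSeq f hf (ε / k) (by positivity))
  filter_upwards [h] with N hN
  rw [one_mul, Finset.sum_range_mul_eq_sum_sum, Nat.cast_mul, mul_inv, mul_assoc,
    inv_mul_le_iff₀ hk', mul_add, mul_div_cancel₀ _ hk'.ne'] at hN
  refine le_trans ?_ hN
  gcongr with n _
  rw [← Function.iterate_mul]
  exact Finset.single_le_sum (f := fun j => f (T^[k * n + j] x)) (fun j _ => hf _)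
    (Finset.mem_range.2 hk)

/-- Group the `T`-orbit in blocks of length `k`: a block sum is an almost everywhere continuous
function on the `T^[k]`-orbit with integral `k * ∫ f`. -/
theorem IsGenericFor.isDominatedSeq_of_iterate {X : Type*} [TopologicalSpace X] [MeasurableSpace X]
    [CompactSpace X] [HasOuterApproxClosed X] [OpensMeasurableSpace X] {μ : Measure X}
    [IsProbabilityMeasure μ] {T : X → X} (hT : MeasurePreserving T μ μ)
    (hcont : ∀ k : ℕ, ∃ D : Set X, IsClosed D ∧ μ D = 0 ∧ ∀ x ∉ D, ContinuousAt T^[k] x)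
    {x : X} {k : ℕ} (hk : 0 < k) (hx : IsGenericFor μ T^[k] x) :
    IsDominatedSeq μ k (fun n => T^[n] x) := by
  intro f hf ε hε
  obtain ⟨B, hB⟩ := (isCompact_range f.continuous).isBounded.exists_norm_le
  have hB' : ∀ y, |f y| ≤ B := fun y => hB _ ⟨y, rfl⟩
  choose D hDc hD0 hDcont using hcont
  have hfi := f.integrable_of_isFiniteMeasure μ
  have hint : ∀ j ∈ Finset.range k, Integrable (fun y => f (T^[j] y)) μ := fun j _ =>
    (hT.iterate j).integrable_comp_of_integrable hfi
  have hh := hx.tendsto_average (D := ⋃ j ∈ Finset.range k, D j)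
    (h := fun y => ∑ j ∈ Finset.range k, f (T^[j] y)) (B := k * B)
    (isClosed_biUnion_finset fun k _ => hDc k)
    ((measure_biUnion_null_iff (Finset.countable_toSet _)).2 fun k _ => hD0 k)
    (integrable_finsetSum _ hint)
    (fun y => (Finset.abs_sum_le_sum_abs _ _).trans
      ((Finset.sum_le_sum fun j _ => hB' _).trans_eq (by simp)))
    (fun y hy => by
      simp only [Set.mem_iUnion, not_exists] at hy
      exact tendsto_finsetSum _ fun j hj => f.continuous.continuousAt.comp (hDcont j y (hy j hj)))
  have hI : ∫ y, ∑ j ∈ Finset.range k, f (T^[j] y) ∂μ = k * ∫ y, f y ∂μ := by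
    rw [integral_finsetSum _ hint]
    have : ∀ j, ∫ y, f (T^[j] y) ∂μ = ∫ y, f y ∂μ := fun j => by
      have hj := hT.iterate j
      rw [← integral_map hj.measurable.aemeasurable
        f.continuous.measurable.aestronglyMeasurable, hj.map_eq]
    simp [this]
  rw [hI] at hh
  filter_upwards [hh.eventually_lt_const (lt_add_of_pos_right _ hε)] with N hN
  refine le_trans ?_ hN.le
  refine mul_le_mul_of_nonneg_left ?_ (by positivity)
  -- Enlarging `N` to `k * N` is wasteful but avoids remainders modulo `k`; only some constant is
  -- needed.
  calc ∑ n ∈ Finset.range N, f (T^[n] x) ≤ ∑ n ∈ Finset.range (k * N), f (T^[n] x) :=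
        Finset.sum_le_sum_of_subset_of_nonneg
          (Finset.range_subset_range.2 (Nat.le_mul_of_pos_left N hk)) fun _ _ _ => hf _
    _ = _ := by
      rw [Finset.sum_range_mul_eq_sum_sum]
      refine Finset.sum_congr rfl fun n _ => Finset.sum_congr rfl fun j _ => ?_
      rw [← Function.iterate_mul, Nat.add_comm, Function.iterate_add_apply]

/-- The exponent is positive because the base-`1` map sends `1` to `0` and so is not the identity.
-/
theorem flippedMap_zero_iterate {r : ℕ} (hr : 0 < r) (k : ℕ) :
    (flippedMap r 0)^[k + 1] = flippedMap (r ^ (k + 1)) 0 := by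
  funext x
  induction k with
  | zero =>
    ext
    simp [flippedMap_zero_flips hr, flippedMap_zero_flips (pow_pos hr _)]
  | succ k ih =>
    rw [Function.iterate_succ_apply', ih]
    ext
    rw [flippedMap_zero_flips hr, flippedMap_zero_flips (pow_pos hr _),
      flippedMap_zero_flips (pow_pos hr _), Int.fract_eq_fract]
    refine ⟨-(r * ⌊((r ^ (k + 1) : ℕ) : ℝ) * x⌋), ?_⟩
    rw [Int.fract]
    push_cast
    ring

theorem isGenericFor_flippedMap_pow_iff {r : ℕ} (hr : 1 < r) {k : ℕ} (hk : 0 < k)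
    (x : unitInterval) :
    IsGenericFor volume (flippedMap (r ^ k) 0) x ↔ IsGenericFor volume (flippedMap r 0) x := by
  have hr0 : 0 < r := by lia
  have e : (flippedMap r 0)^[k] = flippedMap (r ^ k) 0 := by
    obtain ⟨m, rfl⟩ := Nat.exists_eq_add_one.2 hk
    exact flippedMap_zero_iterate hr0 m
  constructor <;> intro h
  · rw [← e] at h
    refine IsDominatedSeq.isGenericFor_flippedMap hr (Nat.cast_nonneg k)
      (h.isDominatedSeq_of_iterate (measurePreserving_flippedMap hr0) (fun j =>
        ⟨_, isClosed_setOf_mul_eq_intCast ((r : ℝ) ^ j),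
        volume_setOf_mul_eq_intCast (by positivity), fun _ hy =>
        continuousAt_flippedMap_iterate hr0 j hy⟩) hk)
  · have h1 := h.isDominatedSeq_iterate hk
    rw [e] at h1
    exact h1.isGenericFor_flippedMap (Nat.one_lt_pow hk.ne' hr) (Nat.cast_nonneg k)

/-- As `q, r > 1`, exponents of the same sign cannot give product `1`, and neither exponent can
vanish alone. -/
theorem MultiplicativelyDependent.exists_pow_eq_pow {q r : ℕ} (hq : 1 < q) (hr : 1 < r)
    (h : MultiplicativelyDependent (q : ℤ) (r : ℤ)) :
    ∃ a b : ℕ, 0 < a ∧ 0 < b ∧ q ^ a = r ^ b := by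
  obtain ⟨-, -, ⟨i, j⟩, hij, he⟩ := h
  have hq0 : (q : ℚ) ≠ 0 := by positivity
  have hr0 : (r : ℚ) ≠ 0 := by positivity
  have hpos : ∀ {a b : ℕ}, ¬ (a = 0 ∧ b = 0) → q ^ a = r ^ b → 0 < a ∧ 0 < b := by
    intro a b hab h
    refine ⟨Nat.pos_of_ne_zero fun h0 => hab ⟨h0, ?_⟩, Nat.pos_of_ne_zero fun h0 => hab ⟨?_, h0⟩⟩
    · rw [h0, pow_zero, eq_comm, Nat.pow_eq_one] at h
      lia
    · rw [h0, pow_zero, Nat.pow_eq_one] at h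
      lia
  have hmul : ∀ {a b : ℕ}, ¬ (a = 0 ∧ b = 0) → q ^ a * r ^ b ≠ 1 := by
    intro a b hab h
    rw [mul_eq_one, Nat.pow_eq_one, Nat.pow_eq_one] at h
    lia
  simp only [Int.cast_natCast] at he
  obtain ⟨a, rfl | rfl⟩ := i.eq_nat_or_neg <;> obtain ⟨b, rfl | rfl⟩ := j.eq_nat_or_neg <;>
  have hab : ¬ (a = 0 ∧ b = 0) := by
    rintro ⟨rfl, rfl⟩
    exact hij (by simp)
  all_goals simp only [zpow_neg, zpow_natCast] at he
  · exact absurd (by exact_mod_cast he) (hmul hab)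
  · rw [mul_inv_eq_one₀ (pow_ne_zero _ hr0)] at he
    have he' : q ^ a = r ^ b := by exact_mod_cast he
    exact ⟨a, b, (hpos hab he').1, (hpos hab he').2, he'⟩
  · rw [inv_mul_eq_one₀ (pow_ne_zero _ hq0)] at he
    have he' : q ^ a = r ^ b := by exact_mod_cast he
    exact ⟨a, b, (hpos hab he').1, (hpos hab he').2, he'⟩
  · rw [← mul_inv, inv_eq_one] at he
    exact absurd (by exact_mod_cast he) (hmul hab)

theorem isGenericFor_flippedMap_iff {r : ℕ} (hr : 1 < r) (s : Fin r → Fin 2) (x : unitInterval) :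
    IsGenericFor volume (flippedMap r s) x ↔ IsGenericFor volume (flippedMap r 0) x :=
  ⟨fun h => h.flippedMap_of_flips hr 0, fun h => h.flippedMap_of_flips hr s⟩

theorem genericPointEquivalent_flippedMap {q r : ℕ} (hq : 1 < q) (hr : 1 < r)
    (h : MultiplicativelyDependent (q : ℤ) (r : ℤ)) (t : Fin q → Fin 2) (s : Fin r → Fin 2) :
    GenericPointEquivalent (volume : Measure unitInterval) (flippedMap q t) volume
      (flippedMap r s) := by
  obtain ⟨a, b, ha, hb, hab⟩ := h.exists_pow_eq_pow hq hr
  ext x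
  simp only [Set.mem_ofPred_eq]
  rw [isGenericFor_flippedMap_iff hq, isGenericFor_flippedMap_iff hr,
    ← isGenericFor_flippedMap_pow_iff hq ha, ← isGenericFor_flippedMap_pow_iff hr hb, hab]

end Iterate

/-! ### Genericity and normality. -/

section Digits

variable {b : ℕ} [NeZero b]

theorem digits_flippedMap_zero (x : unitInterval) (j : ℕ) :
    Real.digits (flippedMap b 0 x : ℝ) b j = Real.digits (x : ℝ) b (j + 1) := by
  have hx0 : 0 ≤ (b : ℝ) * x := mul_nonneg (Nat.cast_nonneg _) x.2.1
  have h1 : (x : ℝ) * (b : ℝ) ^ (j + 1 + 1) =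
      Int.fract ((b : ℝ) * x) * (b : ℝ) ^ (j + 1) + ((⌊(b : ℝ) * x⌋₊ * b ^ (j + 1) : ℕ) : ℝ) := by
    push_cast
    rw [natCast_floor_eq_intCast_floor hx0, ← add_mul, Int.fract_add_floor]
    ring
  ext
  rw [flippedMap_zero_flips (NeZero.pos b)]
  simp only [Real.digits, Fin.val_ofNat]
  rw [h1, Nat.floor_add_natCast (mul_nonneg (Int.fract_nonneg _) (by positivity)), pow_succ b j,
    ← mul_assoc, Nat.add_mul_mod_self_right]

theorem digits_flippedMap_zero_iterate (x : unitInterval) (n j : ℕ) :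
    Real.digits ((flippedMap b 0)^[n] x : unitInterval) b j = Real.digits (x : ℝ) b (n + j) := by
  induction n generalizing x with
  | zero => simp
  | succ n ih =>
    rw [Function.iterate_succ_apply, ih, digits_flippedMap_zero]
    congr 1
    lia

theorem digits_affineBranch_zero (i : Fin b) {y : unitInterval} (hy : (y : ℝ) < 1) :
    Real.digits (affineBranch i 0 y : unitInterval) b 0 = i := by
  have hb : (b : ℝ) ≠ 0 := NeZero.ne _
  ext
  have h1 : ((affineBranch i 0 y : unitInterval) : ℝ) * (b : ℝ) ^ (0 + 1) = (i : ℕ) + (y : ℝ) := by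
    simp [affineBranch, hb]
  have h2 : ⌊((i : ℕ) : ℝ) + (y : ℝ)⌋₊ = i := by
    rw [Nat.floor_eq_iff (add_nonneg (Nat.cast_nonneg _) y.2.1)]
    constructor <;> linarith [y.2.1]
  simp only [Real.digits, Fin.val_ofNat, h1, h2]
  exact Nat.mod_eq_of_lt i.2

/-- The indicator function of the points whose base-`b` expansion starts with the pattern `w`. -/
noncomputable def cylinderIndicator {L : ℕ} (w : Fin L → Fin b) (y : unitInterval) : ℝ :=
  if ∀ j : Fin L, Real.digits (y : ℝ) b j = w j then 1 else 0

theorem abs_cylinderIndicator_le {L : ℕ} (w : Fin L → Fin b) (y : unitInterval) :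
    |cylinderIndicator w y| ≤ 1 := by
  unfold cylinderIndicator
  split_ifs <;> simp

theorem measurable_cylinderIndicator {L : ℕ} (w : Fin L → Fin b) :
    Measurable (cylinderIndicator w) := by
  refine Measurable.ite ?_ measurable_const measurable_const
  rw [Set.ofPred_forall]
  refine MeasurableSet.iInter fun j => ?_
  have : Measurable fun y : unitInterval => Real.digits (y : ℝ) b j :=
    (measurable_from_top (f := Fin.ofNat b)).comp (Nat.measurable_floor.comp (by fun_prop))
  exact this (measurableSet_singleton (w j))

theorem integrable_cylinderIndicator {L : ℕ} (w : Fin L → Fin b) :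
    Integrable (cylinderIndicator w) :=
  Integrable.of_bound (measurable_cylinderIndicator w).aestronglyMeasurable 1
    (ae_of_all _ (abs_cylinderIndicator_le w))

/-- Branch `i` prepends the digit `i`, so only the branch `w 0` contributes, with the tail of `w` as
the new pattern. -/
theorem integral_cylinderIndicator {L : ℕ} (w : Fin L → Fin b) :
    ∫ y, cylinderIndicator w y = 1 / (b : ℝ) ^ L := by
  have hb : (b : ℝ) ≠ 0 := NeZero.ne _
  induction L with
  | zero => simp [cylinderIndicator]
  | succ L ih =>
    rw [integral_eq_sum_integral_affineBranch (NeZero.pos b) 0 (measurable_cylinderIndicator w)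
      (abs_cylinderIndicator_le w)]
    have h1 : ∀ i : Fin b, ∫ y, cylinderIndicator w (affineBranch i ((0 : Fin b → Fin 2) i) y) =
        if i = w 0 then 1 / (b : ℝ) ^ L else 0 := by
      intro i
      have h2 : ∀ᵐ y : unitInterval, cylinderIndicator w (affineBranch i 0 y) =
          if i = w 0 then cylinderIndicator (fun j => w j.succ) y else 0 := by
        filter_upwards [measure_eq_zero_iff_ae_notMem.1 (measure_singleton (μ := volume)
          (0 : unitInterval)), measure_eq_zero_iff_ae_notMem.1 (measure_singleton (μ := volume)
          (1 : unitInterval))] with y hy0 hy1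
        have hT : flippedMap b 0 (affineBranch i 0 y) = y :=
          flippedMap_affineBranch (s := 0) i hy0 hy1
        have hd : ∀ j : ℕ, Real.digits (affineBranch i 0 y : unitInterval) b (j + 1) =
            Real.digits (y : ℝ) b j := fun j => by rw [← digits_flippedMap_zero, hT]
        have hd0 := digits_affineBranch_zero i (unitInterval.lt_one_iff_ne_one.2 hy1)
        simp only [cylinderIndicator, Fin.forall_fin_succ, Fin.val_zero, Fin.val_succ, hd, hd0]
        split_ifs <;> simp_all
      rw [Pi.zero_apply, integral_congr_ae h2]
      split_ifs
      · exact ih _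
      · simp
    rw [Finset.sum_congr rfl fun i _ => h1 i]
    simp [pow_succ]

/-- Digit `j` can jump only where `b ^ (j + 1) * x` is an integer, and then so is `b ^ L * x`. -/
theorem continuousAt_cylinderIndicator {L : ℕ} (w : Fin L → Fin b) {x : unitInterval}
    (hx : ¬ ∃ n : ℤ, (b : ℝ) ^ L * x = n) : ContinuousAt (cylinderIndicator w) x := by
  have h1 : ∀ j : Fin L, ∀ᶠ y : unitInterval in 𝓝 x,
      Real.digits (y : ℝ) b j = Real.digits (x : ℝ) b j := by
    intro j
    have hx0 : 0 ≤ (x : ℝ) * (b : ℝ) ^ ((j : ℕ) + 1) := mul_nonneg x.2.1 (by positivity)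
    have hlt : (⌊(x : ℝ) * (b : ℝ) ^ ((j : ℕ) + 1)⌋₊ : ℝ) < (x : ℝ) * (b : ℝ) ^ ((j : ℕ) + 1) := by
      refine lt_of_le_of_ne (Nat.floor_le hx0) fun h => hx
        ⟨b ^ (L - (j + 1)) * ⌊(x : ℝ) * (b : ℝ) ^ ((j : ℕ) + 1)⌋₊, ?_⟩
      have hL : L = (L - (j + 1)) + (j + 1) := by lia
      push_cast
      rw [h]
      conv_lhs => rw [hL, pow_add]
      ring
    have hc : Continuous fun y : unitInterval => (y : ℝ) * (b : ℝ) ^ ((j : ℕ) + 1) := by fun_prop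
    filter_upwards [(hc.tendsto x).eventually (Ioo_mem_nhds hlt (Nat.lt_floor_add_one _))]
      with y hy
    simp only [Real.digits]
    rw [(Nat.floor_eq_iff (mul_nonneg y.2.1 (by positivity))).2 ⟨hy.1.le, hy.2⟩]
  refine (continuousAt_const (y := cylinderIndicator w x)).congr ?_
  filter_upwards [eventually_all.2 h1] with y hy
  simp only [cylinderIndicator, hy]

theorem isNormalInBase_iff (x : unitInterval) :
    IsNormalInBase b x ↔ ∀ (L : ℕ) (w : Fin L → Fin b),
      Tendsto (fun N : ℕ => (N : ℝ)⁻¹ *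
        ∑ n ∈ Finset.range N, cylinderIndicator w ((flippedMap b 0)^[n] x)) atTop
        (𝓝 (1 / (b : ℝ) ^ L)) := by
  refine forall_congr' fun L => forall_congr' fun w => ?_
  simp only [cylinderIndicator, digits_flippedMap_zero_iterate, Finset.sum_boole, div_eq_inv_mul]

theorem IsGenericFor.isNormalInBase {x : unitInterval}
    (hx : IsGenericFor volume (flippedMap b 0) x) : IsNormalInBase b x := by
  rw [isNormalInBase_iff]
  intro L w
  rw [← integral_cylinderIndicator w]
  have hb : (b : ℝ) ≠ 0 := NeZero.ne _
  exact hx.tendsto_average (isClosed_setOf_mul_eq_intCast ((b : ℝ) ^ L))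
    (volume_setOf_mul_eq_intCast (pow_ne_zero _ hb)) (integrable_cylinderIndicator w)
    (abs_cylinderIndicator_le w) fun y hy => continuousAt_cylinderIndicator w hy

/-- In `Real.digits` all digits of `1` are `0`. The point must be ruled out because digits recover a
number only on `[0,1)`. -/
theorem not_isNormalInBase_one (hb : 1 < b) : ¬ IsNormalInBase b 1 := by
  intro h
  have h1 := h 1 fun _ => ⟨1, hb⟩
  have h2 : ∀ n : ℕ, ¬ ∀ j : Fin 1, Real.digits ((1 : unitInterval) : ℝ) b (n + j) = ⟨1, hb⟩ := by
    intro n hn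
    have h3 := congrArg Fin.val (hn 0)
    have h4 : ⌊((1 : unitInterval) : ℝ) * (b : ℝ) ^ (n + ((0 : Fin 1) : ℕ) + 1)⌋₊ = b ^ (n + 1) := by
      rw [Set.Icc.coe_one, one_mul, ← Nat.cast_pow, Nat.floor_natCast]
      simp
    simp only [Real.digits, Fin.val_ofNat, h4] at h3
    simp [pow_succ] at h3
  simp only [h2, Finset.filter_false, Finset.card_empty, Nat.cast_zero, zero_div] at h1
  have h5 := tendsto_nhds_unique h1 tendsto_const_nhds
  have : (b : ℝ) ≠ 0 := NeZero.ne _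
  simp [this] at h5

/-- The point whose base-`b` expansion is the pattern `w` followed by zeros. -/
noncomputable def cylinderPoint {L : ℕ} (w : Fin L → Fin b) : unitInterval :=
  ⟨Real.ofDigits fun i => if h : i < L then w ⟨i, h⟩ else 0, Real.ofDigits_nonneg _,
    Real.ofDigits_le_one _⟩

theorem abs_sub_cylinderPoint_le (hb : 1 < b) (L : ℕ) {y : unitInterval} (hy : (y : ℝ) < 1) :
    |(y : ℝ) - cylinderPoint (fun j : Fin L => Real.digits (y : ℝ) b j)| ≤ ((b : ℝ) ^ L)⁻¹ := by
  conv_lhs => rw [← Real.ofDigits_digits hb ⟨y.2.1, hy⟩]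
  refine Real.abs_ofDigits_sub_ofDigits_le fun i hi => ?_
  simp [hi, Real.ofDigits_digits hb ⟨y.2.1, hy⟩]

theorem sum_mul_cylinderIndicator {L : ℕ} (c : (Fin L → Fin b) → ℝ) (y : unitInterval) :
    ∑ w, c w * cylinderIndicator w y = c fun j => Real.digits (y : ℝ) b j := by
  have h : ∀ w : Fin L → Fin b, c w * cylinderIndicator w y =
      if (fun j : Fin L => Real.digits (y : ℝ) b j) = w then c w else 0 := fun w => by
    simp [cylinderIndicator, funext_iff]
  rw [Finset.sum_congr rfl fun w _ => h w]
  simp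

theorem IsNormalInBase.isGenericFor (hb : 1 < b) {x : unitInterval} (hx : IsNormalInBase b x) :
    IsGenericFor volume (flippedMap b 0) x := by
  intro f
  have hlt : ∀ n : ℕ, (((flippedMap b 0)^[n] x : unitInterval) : ℝ) < 1 := by
    intro n
    cases n with
    | zero =>
      refine unitInterval.lt_one_iff_ne_one.2 fun h => not_isNormalInBase_one hb ?_
      rwa [← (show x = 1 from h)]
    | succ n =>
      rw [Function.iterate_succ_apply', flippedMap_zero_flips (by lia)]
      exact Int.fract_lt_one _
  rw [isNormalInBase_iff] at hx
  rw [Metric.tendsto_atTop']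
  refine fun ε hε => eventually_atTop.1 ?_ |>.imp fun N hN n hn => hN n hn.le
  obtain ⟨δ, hδ, hf⟩ := Metric.uniformContinuous_iff.1
    (CompactSpace.uniformContinuous_of_continuous f.continuous) (ε / 3) (by positivity)
  have hb1 : (1 : ℝ) < b := by exact_mod_cast hb
  obtain ⟨L, hL⟩ := pow_unbounded_of_one_lt δ⁻¹ hb1
  -- Replace `f` by its value at the left endpoint of the rank-`L` cylinder; for `b ^ L > δ⁻¹` the
  -- error is at most `ε / 3`, and normality gives the averages of `F`.
  let F : unitInterval → ℝ := fun y => ∑ w : Fin L → Fin b,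
    f (cylinderPoint w) * cylinderIndicator w y
  have hF : ∀ y : unitInterval, (y : ℝ) < 1 → |f y - F y| ≤ ε / 3 := by
    intro y hy
    simp only [F]
    rw [sum_mul_cylinderIndicator (fun w => f (cylinderPoint w)) y]
    refine (hf ?_).le
    rw [Subtype.dist_eq, Real.dist_eq]
    exact (abs_sub_cylinderPoint_le hb L hy).trans_lt (inv_lt_of_inv_lt₀ hδ hL)
  have hFi : ∀ w ∈ (Finset.univ : Finset (Fin L → Fin b)),
      Integrable (fun y => f (cylinderPoint w) * cylinderIndicator w y) := fun w _ =>
    (integrable_cylinderIndicator w).const_mul _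
  have hFint : ∫ y, F y = ∑ w : Fin L → Fin b, f (cylinderPoint w) * (1 / (b : ℝ) ^ L) := by
    simp only [F]
    rw [integral_finsetSum _ hFi]
    simp only [integral_const_mul, integral_cylinderIndicator]
  have hFlim : Tendsto (fun N : ℕ => (N : ℝ)⁻¹ * ∑ n ∈ Finset.range N, F ((flippedMap b 0)^[n] x))
      atTop (𝓝 (∫ y, F y)) := by
    rw [hFint]
    refine (tendsto_finsetSum Finset.univ fun w _ =>
      (hx L w).const_mul (f (cylinderPoint w))).congr fun N => ?_
    simp only [F]
    rw [Finset.sum_comm, Finset.mul_sum]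
    refine Finset.sum_congr rfl fun w _ => ?_
    rw [← Finset.mul_sum]
    ring
  have hint : |(∫ y, f y) - ∫ y, F y| ≤ ε / 3 := by
    rw [← integral_sub (f.integrable_of_isFiniteMeasure volume) (integrable_finsetSum _ hFi)]
    have h := norm_integral_le_of_norm_le_const (μ := volume) (f := fun y => f y - F y)
      (C := ε / 3) (by
        filter_upwards [measure_eq_zero_iff_ae_notMem.1 (measure_singleton (μ := volume)
          (1 : unitInterval))] with y hy
        exact hF y (unitInterval.lt_one_iff_ne_one.2 hy))
    rwa [probReal_univ, mul_one] at h
  filter_upwards [(Metric.tendsto_nhds.1 hFlim) (ε / 3) (by positivity),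
    eventually_gt_atTop 0] with N h1 hN
  have hN' : (N : ℝ) ≠ 0 := by positivity
  have h2 : |(N : ℝ)⁻¹ * ∑ n ∈ Finset.range N,
      (f ((flippedMap b 0)^[n] x) - F ((flippedMap b 0)^[n] x))| ≤ ε / 3 := by
    rw [abs_mul, abs_inv, Nat.abs_cast]
    calc _ ≤ (N : ℝ)⁻¹ * ∑ n ∈ Finset.range N, ε / 3 := by
          gcongr
          exact (Finset.abs_sum_le_sum_abs _ _).trans
            (Finset.sum_le_sum fun n _ => hF _ (hlt n))
      _ = ε / 3 := by
        rw [Finset.sum_const, Finset.card_range, nsmul_eq_mul, inv_mul_cancel_left₀ hN']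
  rw [Finset.sum_sub_distrib, mul_sub] at h2
  rw [Real.dist_eq] at h1 ⊢
  simp only [birkhoffAverage, birkhoffSum, smul_eq_mul]
  rw [abs_lt] at h1 ⊢
  rw [abs_le] at h2 hint
  constructor <;> linarith [h1.1, h1.2, h2.1, h2.2, hint.1, hint.2]

theorem isGenericFor_flippedMap_zero_iff_isNormalInBase (hb : 1 < b) (x : unitInterval) :
    IsGenericFor volume (flippedMap b 0) x ↔ IsNormalInBase b x :=
  ⟨fun h => h.isNormalInBase, fun h => h.isGenericFor hb⟩

end Digits

/-! ### The tent and doubling maps, and the main theorem. -/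

theorem tentMap_eq_flippedMap : tentMap = flippedMap 2 ![0, 1] := by
  funext x
  ext
  have hx0 := x.2.1
  change (if (x : ℝ) < 1 / 2 then 2 * (x : ℝ) else 2 * (1 - (x : ℝ))) = _
  split_ifs with h
  · have hf : ⌊((2 : ℕ) : ℝ) * x⌋₊ = ((0 : Fin 2) : ℕ) := by
      rw [Fin.val_zero, Nat.floor_eq_zero]
      push_cast
      linarith
    rw [flippedMap_eq_of_floor_eq hf]
    simp only [Matrix.cons_val_zero, if_true]
    rw [Int.fract_eq_self.2 ⟨by positivity, by push_cast; linarith⟩]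
    simp
  · rcases eq_or_ne x 1 with rfl | h1
    · simp [flippedMap_one]
    · have hx1 : (x : ℝ) < 1 := unitInterval.lt_one_iff_ne_one.2 h1
      have hf : ⌊((2 : ℕ) : ℝ) * x⌋₊ = ((1 : Fin 2) : ℕ) := by
        rw [Fin.val_one, Nat.floor_eq_iff (by positivity)]
        push_cast
        constructor <;> linarith
      rw [flippedMap_eq_of_floor_eq hf, Int.fract_eq_iff.2
        (⟨?_, ?_, 1, ?_⟩ : 0 ≤ 2 * (x : ℝ) - 1 ∧ 2 * (x : ℝ) - 1 < 1 ∧ _)]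
      · simp
        ring
      · linarith
      · linarith
      · simp

theorem doublingMap_eq_flippedMap : doublingMap = flippedMap 2 ![0, 0] := by
  have h : (![0, 0] : Fin 2 → Fin 2) = 0 := by decide
  funext x
  ext
  rw [h, flippedMap_zero_flips two_pos]
  simp [doublingMap]

theorem mainTheorem5 :
    -- the branches of the flipped maps, and their ergodicity
    (∀ (r : ℕ) (s : Fin r → Fin 2), 1 < r →
      (∀ (i : Fin r) (x : unitInterval),
        (i : ℝ) / (r : ℝ) ≤ (x : ℝ) → (x : ℝ) < ((i : ℝ) + 1) / (r : ℝ) →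
          (s i = 0 → (flippedMap r s x : ℝ) = Int.fract ((r : ℝ) * (x : ℝ))) ∧
          (s i = 1 → (flippedMap r s x : ℝ) = 1 - Int.fract ((r : ℝ) * (x : ℝ)))) ∧
      flippedMap r s 1 = 0 ∧
      Ergodic (flippedMap r s) (volume : Measure unitInterval)) ∧
    -- generic point equivalence for multiplicatively dependent bases
    (∀ (q r : ℕ) (t : Fin q → Fin 2) (s : Fin r → Fin 2), 1 < q → 1 < r →
      MultiplicativelyDependent (q : ℤ) (r : ℤ) →
      GenericPointEquivalent (volume : Measure unitInterval) (flippedMap q t)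
        (volume : Measure unitInterval) (flippedMap r s)) ∧
    -- the special case of the tent map and the doubling map
    tentMap = flippedMap 2 ![0, 1] ∧
    doublingMap = flippedMap 2 ![0, 0] ∧
    GenericPointEquivalent (volume : Measure unitInterval) tentMap
      (volume : Measure unitInterval) doublingMap ∧
    (∀ x : unitInterval,
      (IsGenericFor (volume : Measure unitInterval) tentMap x ↔ IsNormalInBase 2 x) ∧
      (IsGenericFor (volume : Measure unitInterval) doublingMap x ↔ IsNormalInBase 2 x)) := by
  have hnormal : ∀ (s : Fin 2 → Fin 2) (x : unitInterval),
      IsGenericFor volume (flippedMap 2 s) x ↔ IsNormalInBase 2 x := fun s x =>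
    (isGenericFor_flippedMap_iff one_lt_two s x).trans
      (isGenericFor_flippedMap_zero_iff_isNormalInBase one_lt_two x)
  refine ⟨fun r s hr => ⟨fun i x h1 h2 => ?_, flippedMap_one, ergodic_flippedMap hr s⟩,
    fun q r t s hq hr h => genericPointEquivalent_flippedMap hq hr h t s, tentMap_eq_flippedMap,
    doublingMap_eq_flippedMap, ?_, fun x => ⟨?_, ?_⟩⟩
  · have hr0 : (0 : ℝ) < r := by positivity
    rw [div_le_iff₀' hr0] at h1
    rw [lt_div_iff₀' hr0] at h2
    have hf : ⌊(r : ℝ) * x⌋₊ = i :=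
      (Nat.floor_eq_iff (mul_nonneg hr0.le x.2.1)).2 ⟨h1, h2⟩
    rw [flippedMap_eq_of_floor_eq hf]
    exact ⟨fun h => by simp [h], fun h => by simp [h]⟩
  · ext x
    simp only [Set.mem_ofPred_eq]
    rw [tentMap_eq_flippedMap, doublingMap_eq_flippedMap, hnormal, hnormal]
  · rw [tentMap_eq_flippedMap, hnormal]
  · rw [doublingMap_eq_flippedMap, hnormal]
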